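/- Let $k$ be an algebraically closed field, let $n\ge 1$ be an integer not divisible by $\operatorname{char} k$ (no condition if $\operatorname{char} k=0$), let $a\ge 0$ be an integer coprime to $n$, and let $\xi\in k$ be a primitive $n$-th root of unity. Let $G=\frac1n(1,a)\subset \mathrm{GL}(2,k)$ be the cyclic group generated by $\begin{pmatrix}\xi&0\\0&\xi^a\end{pmatrix}$, acting on $S=k[[u,v]]$ by linear changes of variables, so that the generator sends $u\mapsto \xi u$ and $v\mapsto \xi^a v$. Let $R=S^G$ be the invariant ring, a Noetherian local ring with residue field $k$, and let $M=\mathrm{Syz}^2_R(k)$ be the second syzygy module of $k$, that is, $M=\ker(R^{\beta_1}\to R^{\beta_0})$ for a minimal free resolution $\cdots\to R^{\beta_1}\to R^{\beta_0}\to k\to 0$ of $k$ over $R$. Let $$V=\mathcal A'(M)=(S\otimes_R M)^{**}\otimes_S k,\qquad (-)^*=\mathrm{Hom}_S(-,S),$$ be the $k$-representation of $G$ that corresponds to $M$ under the Auslander correspondence; here $G$ acts on $S\otimes_R M$ through the first factor, on a dual by $g\cdot\varphi=g\circ\varphi\circ g^{-1}$, and on $V=(S\otimes_R M)^{**}/\mathfrak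 m_S(S\otimes_R M)^{**}$ by the induced action. Then $V$ is a faithful representation of $G$, i.e. the homomorphism $G\to \mathrm{GL}(V)$ is injective. -/

import Mathlib

open scoped TensorProduct

/-! ### Linear action of matrices on formal power series -/

namespace LinearAction

variable {k σ : Type*} [Field k] [Fintype σ]

/-- The linear form `g(x_j) = ∑ i, g_{ij} x_i`, the image of the variable `x_j` under the matrix `g`
acting on the space of linear forms with basis `(x_i)`. -/
noncomputable def form (g : Matrix σ σ k) (j : σ) : MvPowerSeries σ k :=
  ∑ i, g i j • MvPowerSeries.X i

theorem hasSubst_form (g : Matrix σ σ k) : MvPowerSeries.HasSubst (form g) :=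
  MvPowerSeries.hasSubst_of_constantCoeff_zero fun j => by
    simp [form, map_sum]

theorem subst_form (g h : Matrix σ σ k) (j : σ) :
    MvPowerSeries.subst (form g) (form h j) = form (g * h) j := by
  rw [← MvPowerSeries.coe_substAlgHom (hasSubst_form g)]
  simp only [form, map_sum, map_smul, MvPowerSeries.substAlgHom_X, Matrix.mul_apply,
    Finset.smul_sum, Finset.sum_smul, smul_smul]
  rw [Finset.sum_comm]
  simp only [mul_comm]

variable [DecidableEq σ]

/-- `GL(σ, k)` acts on `k[[x_i : i ∈ σ]]` by linear changes of variables. -/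
noncomputable instance : MulSemiringAction (GL σ k) (MvPowerSeries σ k) where
  smul g f := MvPowerSeries.subst (form g.1) f
  one_smul f := by
    change MvPowerSeries.subst (form (1 : Matrix σ σ k)) f = f
    have : form (1 : Matrix σ σ k) = MvPowerSeries.X := by
      funext j
      simp [form, Matrix.one_apply]
    rw [this, MvPowerSeries.subst_self, id]
  mul_smul g h f := by
    change MvPowerSeries.subst (form (g.1 * h.1)) f =
      MvPowerSeries.subst (form g.1) (MvPowerSeries.subst (form h.1) f)
    rw [MvPowerSeries.subst_comp_subst_apply (hasSubst_form _) (hasSubst_form _)]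
    congr 1
    funext j
    exact (subst_form _ _ _).symm
  smul_zero g := by
    change MvPowerSeries.subst (form g.1) _ = _
    rw [← MvPowerSeries.coe_substAlgHom (hasSubst_form _), map_zero]
  smul_add g := MvPowerSeries.subst_add (hasSubst_form _)
  smul_one g := by
    change MvPowerSeries.subst (form g.1) _ = _
    rw [← MvPowerSeries.coe_substAlgHom (hasSubst_form _), map_one]
  smul_mul g := MvPowerSeries.subst_mul (hasSubst_form _)

theorem smul_def (g : GL σ k) (f : MvPowerSeries σ k) :
    g • f = MvPowerSeries.subst (form g.1) f := rfl

instance : SMulCommClass (GL σ k) k (MvPowerSeries σ k) where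
  smul_comm g c f := MvPowerSeries.subst_smul (hasSubst_form g.1) c f

end LinearAction

/-- The cyclic group `1/n (1, a)` in `GL(2, k)`: the subgroup generated by the diagonal matrix with
entries `ξ, ξ ^ a` (to be used for `ξ` a primitive `n`-th root of unity). -/
noncomputable def cyclicGroup {k : Type*} [Field k] (ξ : kˣ) (a : ℕ) :
    Subgroup (GL (Fin 2) k) :=
  Subgroup.zpowers
    (Matrix.GeneralLinearGroup.mk' (Matrix.diagonal ![(ξ : k), (ξ : k) ^ a])
      (invertibleOfNonzero (by simp [Matrix.det_diagonal])))

/-! ### Invariant rings -/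

section Invariants

variable (k S G : Type*) [CommRing k] [CommRing S] [Algebra k S] [Group G]
  [MulSemiringAction G S] [SMulCommClass G k S]

/-- The invariant ring `S ^ G`, as a `k`-subalgebra of `S`. -/
abbrev InvariantRing : Subalgebra k S := FixedPoints.subalgebra k S G

instance InvariantRing.isLocalRing [IsLocalRing S] : IsLocalRing (InvariantRing k S G) := by
  have : IsLocalHom (InvariantRing k S G).val.toRingHom := by
    refine ⟨fun x hx => ?_⟩
    obtain ⟨u, hu⟩ := hx
    have hu' : (u : S) = (x : S) := hu
    have hinv : ∀ g : G, g • ((u⁻¹ : Sˣ) : S) = ((u⁻¹ : Sˣ) : S) := fun g => by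
      have h1 : g • (u : S) = u := by rw [hu']; exact x.2 g
      have h2 : (g • ((u⁻¹ : Sˣ) : S)) * (u : S) = 1 := by
        conv_lhs => rw [← h1]
        rw [← smul_mul', Units.inv_mul, smul_one]
      exact (Units.mul_eq_one_iff_eq_inv).1 h2
    refine IsUnit.of_mul_eq_one (⟨((u⁻¹ : Sˣ) : S), hinv⟩ : InvariantRing k S G) ?_
    apply Subtype.ext
    change (x : S) * ((u⁻¹ : Sˣ) : S) = 1
    rw [← hu', Units.mul_inv]
  exact RingHom.domain_isLocalRing (InvariantRing k S G).val.toRingHom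

end Invariants

/-- The invariant ring of a Noetherian ring under a finite group of invertible order is Noetherian
(so that minimal free resolutions over it exist). -/
theorem InvariantRing.isNoetherianRing (k S G : Type*) [Field k] [CommRing S] [Algebra k S]
    [Group G] [Fintype G] [MulSemiringAction G S] [SMulCommClass G k S] [IsNoetherianRing S]
    (h : (Fintype.card G : k) ≠ 0) : IsNoetherianRing (InvariantRing k S G) := by
  let R := InvariantRing k S G
  have key : ∀ I : Ideal R, (I.map (algebraMap R S)).comap (algebraMap R S) = I := by
    let c : k := (Fintype.card G : k)⁻¹
    let ρ : S →ₗ[R] R :=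
      { toFun := fun s => ⟨c • ∑ g : G, g • s, fun g => by
          rw [smul_comm, Finset.smul_sum]
          congr 1
          exact Fintype.sum_equiv (Equiv.mulLeft g) _ _ (fun h => by simp [mul_smul])⟩
        map_add' := fun x y => by ext; simp [Finset.sum_add_distrib]
        map_smul' := fun r x => by
          ext
          have : ∀ g : G, g • (r • x) = r • (g • x) := fun g => smul_comm g r x
          simp only [this, ← Finset.smul_sum, RingHom.id_apply]
          exact smul_comm c r _ }
    have hρ : ∀ r : R, ρ (algebraMap R S r) = r := fun r => by
      ext
      change c • ∑ g : G, g • (r : S) = r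
      have : ∀ g : G, g • (r : S) = r := fun g => r.2 g
      simp only [this, Finset.sum_const, Finset.card_univ]
      rw [← Nat.cast_smul_eq_nsmul k, smul_smul, inv_mul_cancel₀ h, one_smul]
    intro I
    refine le_antisymm ?_ Ideal.le_comap_map
    intro r hr
    rw [Ideal.mem_comap] at hr
    have : ∀ s ∈ I.map (algebraMap R S), ρ s ∈ I := by
      intro s hs
      refine Submodule.span_induction (p := fun s _ => ∀ t : S, ρ (t * s) ∈ I) ?_ ?_ ?_ ?_ hs 1 |>
        fun h => by simpa using h
      · rintro _ ⟨i, hi, rfl⟩ t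
        have : t * algebraMap R S i = i • t := by rw [Algebra.smul_def, mul_comm]
        rw [this, map_smul]
        exact I.mul_mem_right _ hi
      · simp
      · intro x y _ _ hx hy t
        rw [mul_add, map_add]; exact add_mem (hx t) (hy t)
      · intro a x _ hx t
        rw [smul_eq_mul, ← mul_assoc]; exact hx _
    rw [← hρ r]; exact this _ hr
  rw [isNoetherianRing_iff, isNoetherian_iff']
  have : WellFoundedGT (Ideal S) := inferInstance
  exact StrictMono.wellFoundedGT (f := fun I : Ideal R => I.map (algebraMap R S))
    (Monotone.strictMono_of_injective (fun _ _ h => Ideal.map_mono h)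
      (fun I J h => by rw [← key I, ← key J]; exact congrArg _ h))

/-! ### Minimal free resolutions -/

/-- A minimal free resolution `⋯ → R ^ (b 2) → R ^ (b 1) → R ^ (b 0) → M → 0` of the module `M` over
the local ring `R`. -/
structure MinimalFreeResolution (R M : Type*) [CommRing R] [IsLocalRing R] [AddCommGroup M]
    [Module R M] where
  /-- The Betti numbers. -/
  b : ℕ → ℕ
  /-- The augmentation. -/
  ε : (Fin (b 0) → R) →ₗ[R] M
  /-- The differentials. -/
  d : ∀ i, (Fin (b (i + 1)) → R) →ₗ[R] (Fin (b i) → R)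
  surjective : Function.Surjective ε
  exact_zero : LinearMap.range (d 0) = LinearMap.ker ε
  exact_succ : ∀ i, LinearMap.range (d (i + 1)) = LinearMap.ker (d i)
  minimal : ∀ i, LinearMap.range (d i) ≤
    IsLocalRing.maximalIdeal R • (⊤ : Submodule R (Fin (b i) → R))

namespace MinimalFreeResolution

variable {R M : Type*} [CommRing R] [IsLocalRing R] [AddCommGroup M] [Module R M]

/-- The second syzygy module: the kernel of `R ^ (b 1) → R ^ (b 0)`. -/
def secondSyzygy (F : MinimalFreeResolution R M) : Submodule R (Fin (F.b 1) → R) :=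
  LinearMap.ker (F.d 0)

theorem exists_cover (R M : Type*) [CommRing R] [IsLocalRing R] [AddCommGroup M] [Module R M]
    [Module.Finite R M] : ∃ (b : ℕ) (φ : (Fin b → R) →ₗ[R] M), Function.Surjective φ ∧
      LinearMap.ker φ ≤ IsLocalRing.maximalIdeal R • (⊤ : Submodule R (Fin b → R)) := by
  let κ := IsLocalRing.ResidueField R
  let B := Module.finBasis κ (κ ⊗[R] M)
  have hsurj : Function.Surjective (TensorProduct.mk R κ M 1) :=
    TensorProduct.mk_surjective R M κ IsLocalRing.residue_surjective
  choose f hf using fun i => hsurj (B i)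
  refine ⟨_, Fintype.linearCombination R f, ?_, ?_⟩
  · rw [← LinearMap.range_eq_top, Fintype.range_linearCombination]
    exact IsLocalRing.span_eq_top_of_tmul_eq_basis f B hf
  · intro x hx
    have h0 : ∑ i, IsLocalRing.residue R (x i) • B i = 0 := by
      rw [LinearMap.mem_ker, Fintype.linearCombination_apply] at hx
      have := congrArg (TensorProduct.mk R κ M 1) hx
      simpa [map_sum, hf, ← IsLocalRing.ResidueField.algebraMap_eq, algebraMap_smul] using this
    have hx' : ∀ i, x i ∈ IsLocalRing.maximalIdeal R := fun i =>
      (IsLocalRing.residue_eq_zero_iff _).1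
        ((Fintype.linearIndependent_iff.1 B.linearIndependent) _ h0 i)
    rw [pi_eq_sum_univ x]
    exact Submodule.sum_mem _ fun i _ => Submodule.smul_mem_smul (hx' i) Submodule.mem_top

/-- Finitely generated modules over Noetherian local rings have minimal free resolutions. -/
theorem nonempty (R M : Type*) [CommRing R] [IsLocalRing R] [IsNoetherianRing R] [AddCommGroup M]
    [Module R M] [Module.Finite R M] : Nonempty (MinimalFreeResolution R M) := by
  obtain ⟨b₀, ε, hε, hker⟩ := exists_cover R M
  have step : ∀ K : (Σ b : ℕ, Submodule R (Fin b → R)),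
      ∃ (b : ℕ) (f : (Fin b → R) →ₗ[R] (Fin K.1 → R)), LinearMap.range f = K.2 ∧
        LinearMap.ker f ≤ IsLocalRing.maximalIdeal R • (⊤ : Submodule R (Fin b → R)) := by
    intro K
    obtain ⟨b, φ, h1, h2⟩ := exists_cover R K.2
    refine ⟨b, K.2.subtype ∘ₗ φ, ?_, ?_⟩
    · rw [LinearMap.range_comp, LinearMap.range_eq_top.2 h1, Submodule.map_top,
        Submodule.range_subtype]
    · rwa [LinearMap.ker_comp_of_ker_eq_bot _ (Submodule.ker_subtype _)]
  choose nb nf h1 h2 using step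
  let K : ℕ → (Σ b : ℕ, Submodule R (Fin b → R)) := fun i =>
    Nat.rec ⟨b₀, LinearMap.ker ε⟩ (fun _ K => ⟨nb K, LinearMap.ker (nf K)⟩) i
  refine ⟨⟨fun i => (K i).1, ε, fun i => nf (K i), hε, h1 (K 0), fun i => h1 (K (i + 1)), ?_⟩⟩
  intro i
  rw [h1]
  cases i with
  | zero => exact hker
  | succ i => exact h2 (K i)

end MinimalFreeResolution

/-! ### Modules over the skew group ring -/

/-- A structure of module over the skew group ring `S * G` on the `S`-module `X`: an additive action
of `G` on `X` with `g (s x) = g(s) g(x)`. -/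
structure SkewAction (G S X : Type*) [Group G] [CommRing S] [MulSemiringAction G S]
    [AddCommGroup X] [Module S X] where
  /-- The action of an element of the group. -/
  act : G → X →+ X
  act_one : ∀ x, act 1 x = x
  act_mul : ∀ g h x, act (g * h) x = act g (act h x)
  act_smul : ∀ (g : G) (s : S) (x : X), act g (s • x) = (g • s) • act g x

namespace SkewAction

variable {G S X : Type*} [Group G] [CommRing S] [MulSemiringAction G S]
  [AddCommGroup X] [Module S X]

/-- The action of `S * G` on `Hom_S(X, S)`: `g` sends `φ` to `g ∘ φ ∘ g⁻¹`. -/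
def dual (τ : SkewAction G S X) : SkewAction G S (Module.Dual S X) where
  act g :=
    { toFun φ :=
        { toFun x := g • φ (τ.act g⁻¹ x)
          map_add' x y := by simp
          map_smul' s x := by simp [τ.act_smul, smul_mul'] }
      map_zero' := by ext; simp
      map_add' φ ψ := by ext; simp }
  act_one φ := by ext; simp [τ.act_one]
  act_mul g h φ := by ext; simp [mul_smul, τ.act_mul]
  act_smul g s φ := by ext; simp [smul_mul']

theorem act_mem (τ : SkewAction G S X) [IsLocalRing S] (g : G) {x : X}
    (hx : x ∈ IsLocalRing.maximalIdeal S • (⊤ : Submodule S X)) :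
    τ.act g x ∈ IsLocalRing.maximalIdeal S • (⊤ : Submodule S X) := by
  induction hx using Submodule.smul_induction_on' with
  | smul s hs x _ =>
    rw [τ.act_smul]
    refine Submodule.smul_mem_smul ?_ Submodule.mem_top
    rw [IsLocalRing.mem_maximalIdeal, mem_nonunits_iff] at hs ⊢
    intro h
    apply hs
    have := h.map (MulSemiringAction.toRingHom G S g⁻¹)
    simpa using this
  | add x _ y _ hx hy => rw [map_add]; exact add_mem hx hy

section

variable (k : Type*) [Field k] [Algebra k S] [SMulCommClass G k S] [Module k X]
  [IsScalarTower k S X]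

/-- The action of a group element on `X`, which is linear over the invariant field `k`. -/
def actLin (τ : SkewAction G S X) (g : G) : X →ₗ[k] X where
  toFun := τ.act g
  map_add' := map_add _
  map_smul' c x := by
    rw [← algebraMap_smul S c x, τ.act_smul, smul_algebraMap, algebraMap_smul, RingHom.id_apply]

/-- The representation of `G` on `X ⊗_S S/𝔪 = X/𝔪X`, for a local ring `S` with maximal ideal `𝔪`,
induced by an action of `S * G` on `X`: it sends the class of `x` to the class of `g x`. -/
def residueRep [IsLocalRing S] (τ : SkewAction G S X) :
    Representation k G (X ⧸ (IsLocalRing.maximalIdeal S • (⊤ : Submodule S X))) where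
  toFun g :=
    { toFun := Quotient.map' (τ.act g) fun x y hxy => by
        rw [Submodule.quotientRel_def] at hxy ⊢
        rw [← map_sub]
        exact τ.act_mem g hxy
      map_add' := by
        rintro ⟨x⟩ ⟨y⟩
        exact congrArg Submodule.Quotient.mk (map_add (τ.act g) x y)
      map_smul' := by
        rintro c ⟨x⟩
        exact congrArg Submodule.Quotient.mk (map_smul (τ.actLin k g) c x) }
  map_one' := by
    apply LinearMap.ext
    rintro ⟨x⟩
    exact congrArg Submodule.Quotient.mk (τ.act_one x)
  map_mul' g h := by
    apply LinearMap.ext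
    rintro ⟨x⟩
    exact congrArg Submodule.Quotient.mk (τ.act_mul g h x)

end

end SkewAction

/-! ### The functor from modules over the invariant ring to representations -/

section Auslander

variable (k S G : Type*) [Field k] [CommRing S] [Algebra k S] [Group G]
  [MulSemiringAction G S] [SMulCommClass G k S]
  (N : Type*) [AddCommGroup N] [Module (InvariantRing k S G) N]

/-- The action of `S * G` on `S ⊗_R N`, where `R = S ^ G`: `g (s ⊗ x) = g(s) ⊗ x`. -/
noncomputable def baseChangeAction : SkewAction G S (S ⊗[InvariantRing k S G] N) where
  act g := (LinearMap.rTensor N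
    (MulSemiringAction.toAlgHom (InvariantRing k S G) S g).toLinearMap).toAddMonoidHom
  act_one x := by
    induction x with
    | zero => simp
    | tmul s x => simp
    | add x y hx hy => rw [map_add, hx, hy]
  act_mul g h x := by
    induction x with
    | zero => simp
    | tmul s x => simp [mul_smul]
    | add x y hx hy => rw [map_add, hx, hy, map_add, map_add]
  act_smul g s x := by
    induction x with
    | zero => simp
    | tmul t x => simp [TensorProduct.smul_tmul', smul_mul']
    | add x y hx hy => rw [smul_add, map_add, hx, hy, map_add, smul_add]

/-- The `S`-module `(S ⊗_R N)**`, where `R = S ^ G` and `(-)* = Hom_S(-, S)`. -/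
abbrev ReflexiveBaseChange : Type _ :=
  Module.Dual S (Module.Dual S (S ⊗[InvariantRing k S G] N))

/-- The representation `𝒜'(N) = (S ⊗_R N)** ⊗_S S/𝔪` of `G` over `k` which corresponds to the module
`N` over the invariant ring `R = S ^ G` of the local ring `(S, 𝔪)`. -/
noncomputable def auslanderRep [IsLocalRing S] :
    Representation k G (ReflexiveBaseChange k S G N ⧸
      (IsLocalRing.maximalIdeal S • (⊤ : Submodule S (ReflexiveBaseChange k S G N)))) :=
  (baseChangeAction k S G N).dual.dual.residueRep k

end Auslander

/-
Write `R = S ^ G`, let `N ⊆ 𝔪_R R ^ b₁` be the second syzygy module of `k`, and call *coordinates*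
the elements of `S` obtained by evaluating an element of `(S ⊗_R N)**` at a coordinate form of `N`.
The trace `S → R` carries coordinates to entries of elements of `N** = N`, so since `|G|` is
invertible in `k` all coordinates lie in `𝔪_S`. Hence an element `g` of `G` which acts trivially on
`𝒜'(N)` satisfies `g z - z ∈ 𝔪_S ^ 2` for each coordinate `z`.

Now let `i` be the residue of `-a` modulo `n`, let `f` be a generator of the free cover of `k`, and
let `p`, `q` lift `u ^ n f` and `u ^ i v f` to `R ^ b₁`. The syzygy `u ^ i v p - u ^ n q` becomes
divisible by `u ^ i` in `(S ⊗_R N)**`, and the quotient has the coordinate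
`v p_l - u ^ (n - i) q_l` with `p_l` a unit, because `u ^ n` is not in `𝔪_R ^ 2`. So if
`g = diag(c, c ^ a)` acts trivially, comparing coefficients of `v` gives `c ^ a = 1`, and as
`c ^ n = 1` with `a` and `n` coprime, `c = 1`.
-/

open IsLocalRing MvPowerSeries

section FreeModules

variable {R : Type*} [CommRing R] {ι κ : Type*}

theorem mem_smul_top_pi_iff [Finite ι] {I : Ideal R} {x : ι → R} :
    x ∈ I • (⊤ : Submodule R (ι → R)) ↔ ∀ i, x i ∈ I := by
  classical
  have := Fintype.ofFinite ι
  refine ⟨fun hx i => ?_, fun hx => ?_⟩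
  · induction hx using Submodule.smul_induction_on' with
    | smul r hr y _ => exact I.mul_mem_right _ hr
    | add y _ z _ hy hz => exact I.add_mem hy hz
  · rw [pi_eq_sum_univ x]
    exact Submodule.sum_mem _ fun i _ => Submodule.smul_mem_smul (hx i) Submodule.mem_top

/-- The coordinate form `x ↦ x i` on a submodule of `R ^ ι`. -/
def coordForm (N : Submodule R (ι → R)) (i : ι) : Module.Dual R N :=
  LinearMap.proj i ∘ₗ N.subtype

theorem apply_bidual_coordForm [Finite ι] {N : Submodule R (ι → R)}
    (Θ : Module.Dual R (Module.Dual R N)) (φ : Module.Dual R (ι → R)) :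
    φ (fun i => Θ (coordForm N i)) = Θ (φ ∘ₗ N.subtype) := by
  classical
  have := Fintype.ofFinite ι
  have hφ : φ ∘ₗ N.subtype = ∑ i, φ (fun j => if i = j then 1 else 0) • coordForm N i := by
    ext x
    rw [LinearMap.comp_apply, φ.pi_apply_eq_sum_univ]
    simp [coordForm, mul_comm]
  rw [hφ, map_sum, φ.pi_apply_eq_sum_univ]
  simp only [map_smul, smul_eq_mul, mul_comm]

theorem bidual_coordForm_mem_ker [Finite ι] (d : (ι → R) →ₗ[R] (κ → R))
    (Θ : Module.Dual R (Module.Dual R (LinearMap.ker d))) :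
    (fun i => Θ (coordForm (LinearMap.ker d) i)) ∈ LinearMap.ker d := by
  refine LinearMap.mem_ker.2 (funext fun t => ?_)
  have hd : (LinearMap.proj t ∘ₗ d) ∘ₗ (LinearMap.ker d).subtype = 0 :=
    LinearMap.ext fun x => congrFun (LinearMap.mem_ker.1 x.2) t
  exact (apply_bidual_coordForm Θ (LinearMap.proj t ∘ₗ d)).trans (by rw [hd, map_zero])

end FreeModules

section Bidual

variable {S T : Type*} [CommRing S] [IsCancelMulZero S] [AddCommGroup T] [Module S T]

theorem exists_smul_eq_dual_eval {α : S} (hα : α ≠ 0) {t : T}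
    (h : ∀ φ : Module.Dual S T, α ∣ φ t) :
    ∃ w : Module.Dual S (Module.Dual S T), α • w = Module.Dual.eval S T t := by
  choose w hw using h
  refine ⟨⟨⟨w, fun φ ψ => mul_left_cancel₀ hα ?_⟩, fun s φ => mul_left_cancel₀ hα ?_⟩,
    LinearMap.ext fun φ => (hw φ).symm⟩
  · rw [mul_add, ← hw, ← hw, ← hw, LinearMap.add_apply]
  · rw [RingHom.id_apply, smul_eq_mul, mul_left_comm, ← hw, ← hw, LinearMap.smul_apply,
      smul_eq_mul]

end Bidual

namespace MinimalFreeResolution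

variable {R M : Type*} [CommRing R] [IsLocalRing R] [AddCommGroup M] [Module R M]

theorem bidual_coordForm_mem_maximalIdeal (F : MinimalFreeResolution R M)
    (Θ : Module.Dual R (Module.Dual R F.secondSyzygy)) (j : Fin (F.b 1)) :
    Θ (coordForm F.secondSyzygy j) ∈ maximalIdeal R :=
  have h : (fun j => Θ (coordForm F.secondSyzygy j)) ∈ LinearMap.range (F.d 1) :=
    (F.exact_succ 0).symm ▸ bidual_coordForm_mem_ker (F.d 0) Θ
  mem_smul_top_pi_iff.1 (F.minimal 1 h) j

theorem exists_isUnit_apply_of_d_eq_smul (F : MinimalFreeResolution R M) {p : Fin (F.b 1) → R}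
    {f : Fin (F.b 0) → R} {A : R} {t : Fin (F.b 0)} (hp : F.d 0 p = A • f) (ht : IsUnit (f t))
    (hA : A ∉ maximalIdeal R ^ 2) : ∃ l, IsUnit (p l) := by
  by_contra! h
  have hp_mem : p ∈ maximalIdeal R • (⊤ : Submodule R (Fin (F.b 1) → R)) :=
    mem_smul_top_pi_iff.2 fun l => (mem_maximalIdeal _).2 (h l)
  have hdp_mem : A • f ∈ maximalIdeal R ^ 2 • (⊤ : Submodule R (Fin (F.b 0) → R)) := by
    have hdp := Submodule.mem_map_of_mem (f := F.d 0) hp_mem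
    rw [Submodule.map_smul'', Submodule.map_top, hp] at hdp
    rw [sq, Submodule.mul_smul]
    exact Submodule.smul_mono le_rfl (F.minimal 0) hdp
  exact hA ((Ideal.mul_unit_mem_iff_mem _ ht).1 (mem_smul_top_pi_iff.1 hdp_mem t))

section ResidueField

theorem residueField_smul_eq_zero {r : R} (hr : r ∈ maximalIdeal R) (y : ResidueField R) :
    r • y = 0 := by
  rw [Algebra.smul_def, ResidueField.algebraMap_eq, (residue_eq_zero_iff r).2 hr, zero_mul]

variable (F : MinimalFreeResolution R (ResidueField R))

theorem exists_isUnit_apply_of_ε_ne_zero {f : Fin (F.b 0) → R} (hf : F.ε f ≠ 0) :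
    ∃ t, IsUnit (f t) := by
  by_contra! h
  refine hf ?_
  rw [pi_eq_sum_univ f, map_sum]
  refine Finset.sum_eq_zero fun t _ => ?_
  rw [map_smul, residueField_smul_eq_zero ((mem_maximalIdeal _).2 (h t))]

theorem smul_mem_range_d {r : R} (hr : r ∈ maximalIdeal R) (f : Fin (F.b 0) → R) :
    r • f ∈ LinearMap.range (F.d 0) := by
  rw [F.exact_zero, LinearMap.mem_ker, map_smul, residueField_smul_eq_zero hr]

/-- The vectors `p` and `q` lift `A f` and `B f`, where `f` is a generator of the free cover. -/
theorem exists_isUnit_and_smul_sub_smul_mem_secondSyzygy {A B : R} (hA : A ∈ maximalIdeal R)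
    (hA' : A ∉ maximalIdeal R ^ 2) (hB : B ∈ maximalIdeal R) :
    ∃ p q : Fin (F.b 1) → R, (∃ l, IsUnit (p l)) ∧
      ∀ c d : R, c * A = d * B → c • p - d • q ∈ F.secondSyzygy := by
  obtain ⟨f, hf⟩ := F.surjective 1
  obtain ⟨t, ht⟩ := F.exists_isUnit_apply_of_ε_ne_zero (hf.trans_ne one_ne_zero)
  obtain ⟨p, hp⟩ := F.smul_mem_range_d hA f
  obtain ⟨q, hq⟩ := F.smul_mem_range_d hB f
  refine ⟨p, q, F.exists_isUnit_apply_of_d_eq_smul hp ht hA', fun c d hcd => ?_⟩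
  rw [secondSyzygy, LinearMap.mem_ker, map_sub, map_smul, map_smul, hp, hq, smul_smul, smul_smul,
    hcd, sub_self]

end ResidueField

end MinimalFreeResolution

namespace InvariantRing

variable {k S G : Type*} [Field k] [CommRing S] [Algebra k S] [Group G] [MulSemiringAction G S]
  [SMulCommClass G k S]

theorem isUnit_coe_iff {x : InvariantRing k S G} : IsUnit (x : S) ↔ IsUnit x := by
  refine ⟨fun hx => ?_, fun hx => hx.map (InvariantRing k S G).val⟩
  obtain ⟨y, hxy⟩ := hx.exists_right_inv
  have hy (g : G) : g • y = y := hx.mul_left_cancel <| by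
    calc (x : S) * g • y = g • ((x : S) * y) := by rw [smul_mul', x.2 g]
      _ = x * y := by rw [hxy, smul_one]
  exact IsUnit.of_mul_eq_one (⟨y, hy⟩ : InvariantRing k S G) (Subtype.ext hxy)

theorem coe_mem_maximalIdeal_iff [IsLocalRing S] {x : InvariantRing k S G} :
    (x : S) ∈ maximalIdeal S ↔ x ∈ maximalIdeal (InvariantRing k S G) :=
  not_congr isUnit_coe_iff

variable (k G) in
/-- The trace `s ↦ ∑ g, g s`, as a map of modules over the invariant ring. -/
noncomputable def trace [Fintype G] : S →ₗ[InvariantRing k S G] InvariantRing k S G where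
  toFun s := ⟨∑ g : G, g • s, fun h => by
    rw [Finset.smul_sum]
    exact Fintype.sum_equiv (Equiv.mulLeft h) _ _ fun g => (mul_smul h g s).symm⟩
  map_add' s t := Subtype.ext (by simp [Finset.sum_add_distrib])
  map_smul' r s := Subtype.ext <| by
    change ∑ g : G, g • ((r : S) * s) = (r : S) * ∑ g : G, g • s
    rw [Finset.mul_sum]
    exact Finset.sum_congr rfl fun g _ => by rw [smul_mul', r.2 g]

variable [IsLocalRing S]

theorem mem_maximalIdeal_of_trace_mem [Fintype G] (hcard : (Nat.card G : k) ≠ 0)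
    (hres : ∀ (g : G) (s : S), g • s - s ∈ maximalIdeal S) {s : S}
    (hs : trace k G s ∈ maximalIdeal (InvariantRing k S G)) : s ∈ maximalIdeal S := by
  have hsum : (trace k G s : S) - (Nat.card G : k) • s = ∑ g : G, (g • s - s) := by
    rw [Finset.sum_sub_distrib, Finset.sum_const, Finset.card_univ, Nat.cast_smul_eq_nsmul,
      Nat.card_eq_fintype_card]
    rfl
  have hcard_smul : (Nat.card G : k) • s ∈ maximalIdeal S :=
    (Submodule.sub_mem_iff_right _ (coe_mem_maximalIdeal_iff.2 hs)).1
      (hsum ▸ Submodule.sum_mem _ fun g _ => hres g s)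
  exact inv_smul_smul₀ hcard s ▸ Submodule.smul_of_tower_mem _ (Nat.card G : k)⁻¹ hcard_smul

end InvariantRing

theorem SkewAction.act_sub_mem_of_residueRep_eq_one {k S G X : Type*} [Field k] [CommRing S]
    [Algebra k S] [Group G] [MulSemiringAction G S] [SMulCommClass G k S] [IsLocalRing S]
    [AddCommGroup X] [Module S X] [Module k X] [IsScalarTower k S X] {τ : SkewAction G S X} {g : G}
    (hg : τ.residueRep k g = 1) (x : X) :
    τ.act g x - x ∈ maximalIdeal S • (⊤ : Submodule S X) :=
  (Submodule.Quotient.eq _).1 (LinearMap.congr_fun hg (Submodule.Quotient.mk x))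

section Auslander

variable {k S G : Type*} [Field k] [CommRing S] [Algebra k S] [Group G] [MulSemiringAction G S]
  [SMulCommClass G k S] {N : Type*} [AddCommGroup N] [Module (InvariantRing k S G) N]

theorem baseChangeAction_dual_act_baseChange (g : G) (φ : Module.Dual (InvariantRing k S G) N) :
    (baseChangeAction k S G N).dual.act g (φ.baseChange S) = φ.baseChange S := by
  ext x
  change g • φ.baseChange S ((g⁻¹ • (1 : S)) ⊗ₜ x) = φ.baseChange S (1 ⊗ₜ x)
  rw [smul_one, Module.Dual.baseChange_apply_tmul, Algebra.smul_def, mul_one]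
  exact (φ x).2 g

theorem baseChangeAction_dual_dual_act_apply_baseChange (g : G) (w : ReflexiveBaseChange k S G N)
    (φ : Module.Dual (InvariantRing k S G) N) :
    (baseChangeAction k S G N).dual.dual.act g w (φ.baseChange S) = g • w (φ.baseChange S) :=
  congrArg (fun ψ => g • w ψ) (baseChangeAction_dual_act_baseChange g⁻¹ φ)

/-- The map `(S ⊗_R N)** → N**` induced by the trace `S → R`, where `R = S ^ G`. -/
noncomputable def bidualTrace [Fintype G] (w : ReflexiveBaseChange k S G N) :
    Module.Dual (InvariantRing k S G) (Module.Dual (InvariantRing k S G) N) :=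
  InvariantRing.trace k G ∘ₗ w.restrictScalars (InvariantRing k S G) ∘ₗ Module.Dual.baseChange S

theorem exists_smul_eq_eval_one_tmul [IsCancelMulZero S] {α : S} (hα : α ≠ 0)
    {B C : InvariantRing k S G} (hdvd : ∀ s : S, (B : S) ∣ C * s → α ∣ s) {x y : N}
    (hxy : C • x = B • y) :
    ∃ w : ReflexiveBaseChange k S G N,
      α • w = Module.Dual.eval S _ (1 ⊗ₜ[InvariantRing k S G] x) := by
  refine exists_smul_eq_dual_eval hα fun φ => hdvd _ ⟨φ (1 ⊗ₜ y), ?_⟩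
  have hφ (c : InvariantRing k S G) (z : N) : φ (1 ⊗ₜ (c • z)) = c * φ (1 ⊗ₜ z) :=
    (congrArg φ (TensorProduct.tmul_smul c (1 : S) z)).trans (φ.map_smul (c : S) (1 ⊗ₜ z))
  rw [← hφ, hxy, hφ]

variable (k S G N) in
/-- The representation `𝒜'(N)` is faithful. As a definition for arbitrary `S`, it can be stated for
`S = k[[u, v]]` without the costly comparison of the module structures on `𝒜'(N)`. -/
def HasFaithfulAuslanderRep [IsLocalRing S] : Prop :=
  Function.Injective (auslanderRep k S G N)

end Auslander

namespace MinimalFreeResolution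

variable {k S G : Type*} [Field k] [CommRing S] [Algebra k S] [Group G] [MulSemiringAction G S]
  [SMulCommClass G k S] [IsLocalRing S]

section

variable {M : Type*} [AddCommGroup M] [Module (InvariantRing k S G) M]

/-- The map `(S ⊗_R N)** → S` induced by the `l`-th coordinate of the second syzygy module
`N ⊆ R ^ (b 1)`, where `R = S ^ G`. -/
noncomputable def coordEval (F : MinimalFreeResolution (InvariantRing k S G) M) (l : Fin (F.b 1)) :
    ReflexiveBaseChange k S G F.secondSyzygy →ₗ[S] S :=
  Module.Dual.eval S _ ((coordForm F.secondSyzygy l).baseChange S)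

theorem coordEval_mem_maximalIdeal (F : MinimalFreeResolution (InvariantRing k S G) M)
    (hcard : (Nat.card G : k) ≠ 0) (hres : ∀ (g : G) (s : S), g • s - s ∈ maximalIdeal S)
    (w : ReflexiveBaseChange k S G F.secondSyzygy) (l : Fin (F.b 1)) :
    F.coordEval l w ∈ maximalIdeal S := by
  have : Finite G := Nat.finite_of_card_ne_zero fun h => hcard (by rw [h, Nat.cast_zero])
  have := Fintype.ofFinite G
  exact InvariantRing.mem_maximalIdeal_of_trace_mem hcard hres
    (F.bidual_coordForm_mem_maximalIdeal (bidualTrace w) l)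

theorem smul_coordEval_sub_mem_maximalIdeal_sq
    (F : MinimalFreeResolution (InvariantRing k S G) M) (hcard : (Nat.card G : k) ≠ 0)
    (hres : ∀ (g : G) (s : S), g • s - s ∈ maximalIdeal S) {g : G}
    (hg : auslanderRep k S G F.secondSyzygy g = 1)
    (w : ReflexiveBaseChange k S G F.secondSyzygy) (l : Fin (F.b 1)) :
    g • F.coordEval l w - F.coordEval l w ∈ maximalIdeal S ^ 2 := by
  have hrange : LinearMap.range (F.coordEval l) ≤ maximalIdeal S := by
    rintro _ ⟨x, rfl⟩
    exact F.coordEval_mem_maximalIdeal hcard hres x l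
  have hmem := Submodule.mem_map_of_mem (f := F.coordEval l)
    (SkewAction.act_sub_mem_of_residueRep_eq_one hg w)
  rw [Submodule.map_smul'', Submodule.map_top, map_sub] at hmem
  have hact : F.coordEval l ((baseChangeAction k S G F.secondSyzygy).dual.dual.act g w) =
      g • F.coordEval l w := baseChangeAction_dual_dual_act_apply_baseChange g w _
  rw [hact] at hmem
  exact sq (maximalIdeal S) ▸ Submodule.smul_mono le_rfl hrange hmem

/-- The ideal of `S` generated by the coordinates of the elements of `(S ⊗_R N)**`, where `N` is the
second syzygy module. -/
noncomputable def coordIdeal (F : MinimalFreeResolution (InvariantRing k S G) M) : Ideal S :=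
  ⨆ l, LinearMap.range (F.coordEval l)

theorem smul_sub_mem_maximalIdeal_sq_of_mem_coordIdeal
    (F : MinimalFreeResolution (InvariantRing k S G) M) (hcard : (Nat.card G : k) ≠ 0)
    (hres : ∀ (g : G) (s : S), g • s - s ∈ maximalIdeal S) {g : G}
    (hg : auslanderRep k S G F.secondSyzygy g = 1) {z : S} (hz : z ∈ F.coordIdeal) :
    g • z - z ∈ maximalIdeal S ^ 2 := by
  refine Submodule.iSup_induction _ (motive := fun z => g • z - z ∈ maximalIdeal S ^ 2) hz ?_ ?_ ?_
  · rintro l _ ⟨w, rfl⟩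
    exact F.smul_coordEval_sub_mem_maximalIdeal_sq hcard hres hg w l
  · rw [smul_zero, sub_zero]
    exact Submodule.zero_mem _
  · intro z₁ z₂ h₁ h₂
    rw [smul_add, add_sub_add_comm]
    exact Submodule.add_mem _ h₁ h₂

theorem hasFaithfulAuslanderRep_secondSyzygy
    (F : MinimalFreeResolution (InvariantRing k S G) M) (hcard : (Nat.card G : k) ≠ 0)
    (hres : ∀ (g : G) (s : S), g • s - s ∈ maximalIdeal S)
    (hfaithful : ∀ g : G, (∀ z ∈ F.coordIdeal, g • z - z ∈ maximalIdeal S ^ 2) → g = 1) :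
    HasFaithfulAuslanderRep k S G F.secondSyzygy :=
  (injective_iff_map_eq_one _).2 fun g hg => hfaithful g fun _ =>
    F.smul_sub_mem_maximalIdeal_sq_of_mem_coordIdeal hcard hres hg

end

theorem exists_mem_coordIdeal_mul_eq [IsCancelMulZero S]
    (F : MinimalFreeResolution (InvariantRing k S G) (ResidueField (InvariantRing k S G)))
    {A B C D : InvariantRing k S G} (hA : A ∈ maximalIdeal (InvariantRing k S G))
    (hA' : A ∉ maximalIdeal (InvariantRing k S G) ^ 2)
    (hB : B ∈ maximalIdeal (InvariantRing k S G)) (hCA : C * A = D * B) {α : S} (hα : α ≠ 0)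
    (hdvd : ∀ s : S, (B : S) ∣ C * s → α ∣ s) :
    ∃ z ∈ F.coordIdeal, ∃ r r' : InvariantRing k S G,
      IsUnit r ∧ α * z = (B * r - A * r' : S) := by
  obtain ⟨p, q, ⟨l, hl⟩, hpq⟩ := F.exists_isUnit_and_smul_sub_smul_mem_secondSyzygy hA hA' hB
  let x : F.secondSyzygy := ⟨B • p - A • q, hpq B A (mul_comm B A)⟩
  let y : F.secondSyzygy := ⟨C • p - D • q, hpq C D hCA⟩
  have hxy : C • x = B • y := Subtype.ext <| by
    change C • (B • p - A • q) = B • (C • p - D • q)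
    simp only [smul_sub, smul_smul, hCA, mul_comm B]
  obtain ⟨w, hw⟩ := exists_smul_eq_eval_one_tmul (N := F.secondSyzygy) hα hdvd hxy
  refine ⟨F.coordEval l w, Submodule.mem_iSup_of_mem l ⟨w, rfl⟩, p l, q l, hl, ?_⟩
  calc α * F.coordEval l w = (α • w) ((coordForm F.secondSyzygy l).baseChange S) := rfl
    _ = (B * p l - A * q l) • (1 : S) := LinearMap.congr_fun hw _
    _ = B * p l - A * q l := by rw [Algebra.smul_def, mul_one]; rfl

end MinimalFreeResolution

section PowerSeries

theorem mvPowerSeries_X_pow_dvd_of_dvd_X_pow_mul {σ R : Type*} [CommSemiring R] {s t : σ}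
    (hst : s ≠ t) {i j : ℕ} {f : MvPowerSeries σ R}
    (h : (X s : MvPowerSeries σ R) ^ i ∣ X t ^ j * f) : (X s : MvPowerSeries σ R) ^ i ∣ f := by
  classical
  rw [X_pow_dvd_iff] at h ⊢
  intro m hm
  have hcoeff := h (Finsupp.single t j + m) (by simpa [hst] using hm)
  rwa [X_pow_eq, coeff_add_monomial_mul, one_mul] at hcoeff

variable {σ k : Type*} [Field k] {f : MvPowerSeries σ k}

theorem mvPowerSeries_mem_maximalIdeal_iff :
    f ∈ maximalIdeal (MvPowerSeries σ k) ↔ constantCoeff f = 0 := by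
  rw [mem_maximalIdeal, mem_nonunits_iff, isUnit_iff_constantCoeff, isUnit_iff_ne_zero, not_not]

theorem mvPowerSeries_le_order_of_mem_maximalIdeal_pow {n : ℕ}
    (hf : f ∈ maximalIdeal (MvPowerSeries σ k) ^ n) : n ≤ f.order := by
  induction n generalizing f with
  | zero => simp
  | succ n ih =>
    rw [pow_succ] at hf
    induction hf using Submodule.mul_induction_on' with
    | mem_mul_mem p hp q hq =>
      have hq_order : 1 ≤ q.order :=
        one_le_order_iff_constCoeff_eq_zero.2 (mvPowerSeries_mem_maximalIdeal_iff.1 hq)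
      push_cast
      exact (add_le_add (ih hp) hq_order).trans le_order_mul
    | add p _ q _ hp hq => exact (le_min hp hq).trans min_order_le_add

end PowerSeries

namespace LinearAction

variable {k σ : Type*} [Field k] [Fintype σ] [DecidableEq σ]

theorem constantCoeff_smul (g : GL σ k) (f : MvPowerSeries σ k) :
    constantCoeff (g • f) = constantCoeff f := by
  have hC (c : k) : constantCoeff (algebraMap k (MvPowerSeries σ k) c) = c := rfl
  have h := constantCoeff_subst_eq_zero (hasSubst_form g.1) (fun j => by simp [form, map_sum])
    (show constantCoeff (f - algebraMap k _ (constantCoeff f)) = 0 by simp [hC])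
  rwa [← smul_def, smul_sub, smul_algebraMap, map_sub, sub_eq_zero, hC] at h

theorem smul_sub_mem_maximalIdeal (g : GL σ k) (f : MvPowerSeries σ k) :
    g • f - f ∈ maximalIdeal (MvPowerSeries σ k) :=
  mvPowerSeries_mem_maximalIdeal_iff.2 (by rw [map_sub, constantCoeff_smul, sub_self])

theorem coeff_smul_of_eq_diagonal {g : GL σ k} {c : σ → k} (hg : g.1 = Matrix.diagonal c)
    (f : MvPowerSeries σ k) (m : σ →₀ ℕ) :
    coeff m (g • f) = (m.prod fun i e => c i ^ e) * coeff m f := by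
  have hform : form g.1 = c • X := by
    funext j
    simp [form, hg, Matrix.diagonal_apply]
  rw [smul_def, hform, ← rescale_eq_subst, coeff_rescale]

end LinearAction

namespace cyclicGroup

variable {k : Type*} [Field k] {ξ : kˣ} {a n : ℕ}

variable (k a) in
/-- The homomorphism sending `c` to the diagonal matrix with entries `c, c ^ a`; the group
`1/n (1, a)` is generated by its value at a primitive `n`-th root of unity. -/
def diagonalHom : kˣ →* GL (Fin 2) k where
  toFun c := ⟨Matrix.diagonal ![(c : k), (c : k) ^ a],
    Matrix.diagonal ![((c⁻¹ : kˣ) : k), ((c⁻¹ : kˣ) : k) ^ a],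
    by simp [Matrix.one_fin_two, Matrix.diagonal_fin_two],
    by simp [Matrix.one_fin_two, Matrix.diagonal_fin_two]⟩
  map_one' := Units.ext (by simp [Matrix.one_fin_two, Matrix.diagonal_fin_two])
  map_mul' c d := Units.ext (by simp [Matrix.diagonal_fin_two, mul_pow])

theorem diagonalHom_injective : Function.Injective (diagonalHom k a) := fun _ _ h =>
  Units.ext (congrArg (fun A : GL (Fin 2) k => A.1 0 0) h)

theorem eq_zpowers (ξ : kˣ) (a : ℕ) :
    cyclicGroup ξ a = Subgroup.zpowers (diagonalHom k a ξ) :=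
  congrArg Subgroup.zpowers (Units.ext rfl)

theorem diagonalHom_mem (ξ : kˣ) (a : ℕ) : diagonalHom k a ξ ∈ cyclicGroup ξ a :=
  eq_zpowers ξ a ▸ Subgroup.mem_zpowers _

theorem exists_eq_diagonalHom (hξ : ξ ^ n = 1) (g : cyclicGroup ξ a) :
    ∃ c : kˣ, c ^ n = 1 ∧ (g : GL (Fin 2) k) = diagonalHom k a c := by
  obtain ⟨g, hg⟩ := g
  rw [eq_zpowers] at hg
  obtain ⟨j, rfl⟩ := hg
  refine ⟨ξ ^ j, ?_, (map_zpow _ _ _).symm⟩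
  rw [← zpow_natCast, zpow_comm, zpow_natCast, hξ, one_zpow]

theorem card_eq (hξ : IsPrimitiveRoot ξ n) : Nat.card (cyclicGroup ξ a) = n := by
  rw [eq_zpowers, Nat.card_zpowers, orderOf_injective _ diagonalHom_injective, hξ.eq_orderOf]

theorem coeff_diagonalHom_smul (c : kˣ) (f : MvPowerSeries (Fin 2) k) (m : Fin 2 →₀ ℕ) :
    coeff m (diagonalHom k a c • f) = ((c ^ (m 0 + a * m 1) : kˣ) : k) * coeff m f := by
  rw [LinearAction.coeff_smul_of_eq_diagonal rfl, Finsupp.prod_fintype _ _ (by simp)]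
  simp [pow_add, pow_mul]

theorem pow_eq_one_of_coeff_diagonalHom_smul_eq {c : kˣ} {f : MvPowerSeries (Fin 2) k}
    {m : Fin 2 →₀ ℕ} (hm : coeff m f ≠ 0)
    (h : coeff m (diagonalHom k a c • f) = coeff m f) : c ^ (m 0 + a * m 1) = 1 := by
  rw [coeff_diagonalHom_smul] at h
  exact Units.ext ((mul_eq_right₀ hm).1 h)

theorem mem_invariantRing_iff (hξ : IsPrimitiveRoot ξ n) {f : MvPowerSeries (Fin 2) k} :
    f ∈ InvariantRing k (MvPowerSeries (Fin 2) k) (cyclicGroup ξ a) ↔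
      ∀ m, coeff m f ≠ 0 → n ∣ m 0 + a * m 1 := by
  refine ⟨fun hf m hm => hξ.dvd_of_pow_eq_one _ (pow_eq_one_of_coeff_diagonalHom_smul_eq hm
    (congrArg (coeff m) (hf ⟨_, diagonalHom_mem ξ a⟩))), fun hf g => MvPowerSeries.ext fun m => ?_⟩
  obtain ⟨c, hc, hg⟩ := exists_eq_diagonalHom hξ.pow_eq_one g
  rw [Subgroup.smul_def, hg, coeff_diagonalHom_smul]
  rcases eq_or_ne (coeff m f) 0 with hm | hm
  · rw [hm, mul_zero]
  · obtain ⟨d, hd⟩ := hf m hm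
    rw [hd, pow_mul, hc, one_pow, Units.val_one, one_mul]

theorem X_pow_mul_X_pow_mem_invariantRing (hξ : IsPrimitiveRoot ξ n) {s t : ℕ}
    (h : n ∣ s + a * t) :
    (X 0 ^ s * X 1 ^ t : MvPowerSeries (Fin 2) k) ∈
      InvariantRing k (MvPowerSeries (Fin 2) k) (cyclicGroup ξ a) := by
  classical
  refine (mem_invariantRing_iff hξ).2 fun m hm => ?_
  rw [X_pow_eq, X_pow_eq, monomial_mul_monomial, coeff_monomial] at hm
  obtain ⟨rfl, -⟩ := ite_ne_right_iff.1 hm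
  simpa using h

/-- The invariants `A = u ^ n`, `B = u ^ i v`, `C = v ^ n`, `D = u ^ (n - i) v ^ (n - 1)`. -/
theorem exists_mul_eq_mul_of_dvd_add (hn : 1 ≤ n) (hξ : IsPrimitiveRoot ξ n) {i : ℕ} (hin : i ≤ n)
    (hia : n ∣ i + a) :
    ∃ A B C D : InvariantRing k (MvPowerSeries (Fin 2) k) (cyclicGroup ξ a),
      (A : MvPowerSeries (Fin 2) k) = X 0 ^ n ∧ (B : MvPowerSeries (Fin 2) k) = X 0 ^ i * X 1 ∧
      (C : MvPowerSeries (Fin 2) k) = X 1 ^ n ∧ C * A = D * B := by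
  have hD : n ∣ (n - i) + a * (n - 1) := by
    refine (Nat.dvd_add_left hia).1 ⟨1 + a, ?_⟩
    zify [hin, hn]
    ring
  refine ⟨⟨X 0 ^ n * X 1 ^ 0, X_pow_mul_X_pow_mem_invariantRing hξ (by simp)⟩,
    ⟨X 0 ^ i * X 1 ^ 1, X_pow_mul_X_pow_mem_invariantRing hξ (by simpa using hia)⟩,
    ⟨X 0 ^ 0 * X 1 ^ n, X_pow_mul_X_pow_mem_invariantRing hξ (by simp)⟩,
    ⟨X 0 ^ (n - i) * X 1 ^ (n - 1), X_pow_mul_X_pow_mem_invariantRing hξ hD⟩,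
    by simp, by simp, by simp, Subtype.ext ?_⟩
  change (X 0 ^ 0 * X 1 ^ n) * (X 0 ^ n * X 1 ^ 0) =
    (X 0 ^ (n - i) * X 1 ^ (n - 1)) * (X 0 ^ i * X 1 ^ 1 : MvPowerSeries (Fin 2) k)
  rw [mul_mul_mul_comm, mul_mul_mul_comm (X 0 ^ (n - i))]
  simp only [← pow_add, Nat.sub_add_cancel hin, Nat.sub_add_cancel hn, zero_add, add_zero]

theorem mem_maximalIdeal_iff
    {r : InvariantRing k (MvPowerSeries (Fin 2) k) (cyclicGroup ξ a)} :
    r ∈ maximalIdeal (InvariantRing k (MvPowerSeries (Fin 2) k) (cyclicGroup ξ a)) ↔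
      constantCoeff (r : MvPowerSeries (Fin 2) k) = 0 :=
  InvariantRing.coe_mem_maximalIdeal_iff.symm.trans mvPowerSeries_mem_maximalIdeal_iff

theorem le_of_mem_maximalIdeal_of_coeff_single_ne_zero (hξ : IsPrimitiveRoot ξ n)
    {r : InvariantRing k (MvPowerSeries (Fin 2) k) (cyclicGroup ξ a)}
    (hr : r ∈ maximalIdeal (InvariantRing k (MvPowerSeries (Fin 2) k) (cyclicGroup ξ a))) {e : ℕ}
    (he : coeff (Finsupp.single 0 e) (r : MvPowerSeries (Fin 2) k) ≠ 0) : n ≤ e := by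
  have hdvd : n ∣ e := by simpa using (mem_invariantRing_iff hξ).1 r.2 _ he
  refine Nat.le_of_dvd (Nat.pos_of_ne_zero ?_) hdvd
  rintro rfl
  exact he (by simpa using mem_maximalIdeal_iff.1 hr)

theorem coeff_single_eq_zero_of_mem_maximalIdeal_sq (hn : 1 ≤ n) (hξ : IsPrimitiveRoot ξ n)
    {r : InvariantRing k (MvPowerSeries (Fin 2) k) (cyclicGroup ξ a)}
    (hr : r ∈ maximalIdeal (InvariantRing k (MvPowerSeries (Fin 2) k) (cyclicGroup ξ a)) ^ 2) :
    coeff (Finsupp.single 0 n) (r : MvPowerSeries (Fin 2) k) = 0 := by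
  classical
  rw [sq] at hr
  induction hr using Submodule.mul_induction_on' with
  | mem_mul_mem f hf g hg =>
    refine (coeff_mul _ _ _).trans (Finset.sum_eq_zero fun x hx => by_contra fun hne => ?_)
    rw [Finsupp.antidiagonal_single, Finset.mem_map] at hx
    obtain ⟨⟨b, c⟩, hbc, rfl⟩ := hx
    have hb : n ≤ b :=
      le_of_mem_maximalIdeal_of_coeff_single_ne_zero hξ hf (left_ne_zero_of_mul hne)
    have hc : n ≤ c :=
      le_of_mem_maximalIdeal_of_coeff_single_ne_zero hξ hg (right_ne_zero_of_mul hne)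
    have hsum : b + c = n := Finset.HasAntidiagonal.mem_antidiagonal.1 hbc
    omega
  | add f _ g _ hf hg => exact (map_add (coeff _) _ _).trans (by rw [hf, hg, add_zero])

theorem coeff_single_X_mul_sub_X_pow_mul {i : ℕ} (hi : i ≠ 0) (f g : MvPowerSeries (Fin 2) k) :
    coeff (Finsupp.single 1 1) (X 1 * f - X 0 ^ i * g) = constantCoeff f := by
  have hg : coeff (Finsupp.single 1 1) (X 0 ^ i * g) = 0 :=
    X_pow_dvd_iff.1 (dvd_mul_right _ _) _ (by simpa using hi.bot_lt)
  have hf := coeff_add_monomial_mul (Finsupp.single 1 1) 0 f 1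
  rw [map_sub, hg, sub_zero]
  simpa [X] using hf

theorem exists_lt_dvd_add (hn : 1 ≤ n) (a : ℕ) : ∃ i < n, n ∣ i + a := by
  have : NeZero n := ⟨Nat.one_le_iff_ne_zero.1 hn⟩
  refine ⟨(-(a : ZMod n)).val, ZMod.val_lt _, ?_⟩
  rw [← ZMod.natCast_eq_zero_iff, Nat.cast_add, ZMod.natCast_zmod_val, neg_add_cancel]

theorem exists_mem_coordIdeal_coeff_ne_zero (hn : 1 ≤ n) (hξ : IsPrimitiveRoot ξ n)
    (F : MinimalFreeResolution (InvariantRing k (MvPowerSeries (Fin 2) k) (cyclicGroup ξ a))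
      (ResidueField (InvariantRing k (MvPowerSeries (Fin 2) k) (cyclicGroup ξ a)))) :
    ∃ z ∈ F.coordIdeal, coeff (Finsupp.single 1 1) z ≠ 0 := by
  obtain ⟨i, hin, hia⟩ := exists_lt_dvd_add hn a
  obtain ⟨A, B, C, D, hA, hB, hC, hCA⟩ := exists_mul_eq_mul_of_dvd_add hn hξ hin.le hia
  have hA_mem : A ∈ maximalIdeal _ :=
    mem_maximalIdeal_iff.2 <| by
      rw [hA, map_pow, constantCoeff_X, zero_pow (Nat.one_le_iff_ne_zero.1 hn)]
  have hA_sq : A ∉ maximalIdeal _ ^ 2 := fun h => by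
    simpa [hA, coeff_X_pow] using coeff_single_eq_zero_of_mem_maximalIdeal_sq hn hξ h
  have hB_mem : B ∈ maximalIdeal _ :=
    mem_maximalIdeal_iff.2 (by rw [hB, map_mul, constantCoeff_X, mul_zero])
  have hX : (X 0 : MvPowerSeries (Fin 2) k) ^ i ≠ 0 := fun h => by
    simpa [coeff_X_pow] using congrArg (coeff (Finsupp.single 0 i)) h
  have hdvd (s : MvPowerSeries (Fin 2) k) (hs : (B : MvPowerSeries (Fin 2) k) ∣ C * s) :
      X 0 ^ i ∣ s := by
    rw [hB, hC] at hs
    exact mvPowerSeries_X_pow_dvd_of_dvd_X_pow_mul zero_ne_one (dvd_of_mul_right_dvd hs)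
  obtain ⟨z, hz, r, r', hr, hzr⟩ := F.exists_mem_coordIdeal_mul_eq hA_mem hA_sq hB_mem hCA hX hdvd
  have hz_eq : z = X 1 * (r : MvPowerSeries (Fin 2) k) -
      X 0 ^ (n - i) * (r' : MvPowerSeries (Fin 2) k) := by
    refine mul_left_cancel₀ hX (hzr.trans ?_)
    rw [hA, hB, mul_sub, ← mul_assoc, ← mul_assoc, ← pow_add, Nat.add_sub_cancel' hin.le]
  refine ⟨z, hz, ?_⟩
  rw [hz_eq, coeff_single_X_mul_sub_X_pow_mul (Nat.sub_ne_zero_of_lt hin)]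
  exact fun h => (mem_maximalIdeal _).1 (mem_maximalIdeal_iff.2 h) hr

end cyclicGroup

theorem lemma4p5p5_general {k : Type*} [Field k] {n a : ℕ} (hn : 1 ≤ n) (han : Nat.Coprime a n)
    {ξ : kˣ} (hξ : IsPrimitiveRoot ξ n)
    (F : MinimalFreeResolution (InvariantRing k (MvPowerSeries (Fin 2) k) (cyclicGroup ξ a))
      (ResidueField (InvariantRing k (MvPowerSeries (Fin 2) k) (cyclicGroup ξ a)))) :
    HasFaithfulAuslanderRep k (MvPowerSeries (Fin 2) k) (cyclicGroup ξ a) F.secondSyzygy := by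
  have : NeZero n := ⟨Nat.one_le_iff_ne_zero.1 hn⟩
  have hcard : (Nat.card (cyclicGroup ξ a) : k) ≠ 0 := by
    rw [cyclicGroup.card_eq hξ]
    exact (hξ.map_of_injective (f := Units.coeHom k) Units.val_injective).neZero'.ne
  refine F.hasFaithfulAuslanderRep_secondSyzygy hcard
    (fun g s => LinearAction.smul_sub_mem_maximalIdeal (g : GL (Fin 2) k) s) fun g hg => ?_
  obtain ⟨c, hcn, hgc⟩ := cyclicGroup.exists_eq_diagonalHom hξ.pow_eq_one g
  obtain ⟨z, hz, hv⟩ := cyclicGroup.exists_mem_coordIdeal_coeff_ne_zero hn hξ F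
  have hcoeff := coeff_of_lt_order (d := Finsupp.single 1 1) (lt_of_lt_of_le (by simp)
    (mvPowerSeries_le_order_of_mem_maximalIdeal_pow (hg z hz)))
  rw [map_sub, sub_eq_zero, Subgroup.smul_def, hgc] at hcoeff
  have hca : c ^ a = 1 := by
    simpa using cyclicGroup.pow_eq_one_of_coeff_diagonalHom_smul_eq hv hcoeff
  have hc : c = 1 := by
    simpa [han.gcd_eq_one] using pow_gcd_eq_one.2 ⟨hca, hcn⟩
  exact Subtype.ext (by rw [hgc, hc, map_one, OneMemClass.coe_one])

theorem lemma4p5p5 {k : Type*} [Field k] [IsAlgClosed k] (n a : ℕ) (hn : 1 ≤ n)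
    (hchar : (n : k) ≠ 0) (han : Nat.Coprime a n) (ξ : kˣ) (hξ : IsPrimitiveRoot ξ n)
    (F : MinimalFreeResolution
      (InvariantRing k (MvPowerSeries (Fin 2) k) (cyclicGroup ξ a))
      (IsLocalRing.ResidueField
        (InvariantRing k (MvPowerSeries (Fin 2) k) (cyclicGroup ξ a)))) :
    Function.Injective
      (auslanderRep k (MvPowerSeries (Fin 2) k) (cyclicGroup ξ a) F.secondSyzygy) :=
  lemma4p5p5_general hn han hξ F
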